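/- For a positive integer $k$ let $V=\{1,\dots,4k\}$ and let $W$ be the set of all two-element subsets of $V$. For $A\subseteq V$ with $|A|=2k$ put $S(A)=\{\{a,b\} : a\in A,\ b\in V\setminus A\}\subseteq W$. Let $K_k\subset\{0,1\}^W\subset\mathbb{R}^W$ be the set of the characteristic vectors of the sets $S(A)$, where $A$ ranges over all $2k$-element subsets of $V$, and put $$q(k)=\frac{\frac12\binom{4k}{2k}}{\binom{4k-1}{k-1}},\qquad D_k=\Bigl\{d\in\mathbb{N} : \tbinom{4k}{2}-1\le d<q(k)-1\Bigr\}=\Bigl[\tbinom{4k}{2}-1,\ \lceil q(k)\rceil-2\Bigr]\cap\mathbb{N}.$$ A counterexample to Borsuk's conjecture in dimension $d$ is a bounded set $X\subset\mathbb{R}^d$ with at least two points that is not the union of $d+1$ (possibly empty) subsets each of diameter smaller than that of $X$. Let $p$ be any prime power with $17\le p\le 29$, and let $I=\{2^j : j\ge 4\}\cup\{p\}$. Then: 1. for every $k\in I$ the set $D_k$ is non-empty, and for every $d\in D_k$ the space $\mathbb{R}^d$ contains an isometric copy of $K_k$ that is a counterexample to Borsuk's conjecture in dimension $d$; 2. there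 is no gap between consecutive ranges: if $k<k'$ are consecutive elements of $I$, then $D_k\cup D_{k'}$ is a set of consecutive integers; 3. $\bigcup_{k\in I}D_k=\{d\in\mathbb{N} : d\ge 2015\}$. Consequently, for every $d\ge 2015$ some $K_k$ with $k\in I$ gives (by an isometric copy in $\mathbb{R}^d$) a counterexample to Borsuk's conjecture in dimension $d$; in particular the conjecture is false in every dimension $d\ge 2015$. -/

import Mathlib

namespace BorsukKK

/-- `X` can be divided into `m` parts of smaller diameter. Parts may be empty and need not be
disjoint; for a set `X` with at least two points this is no restriction, because
making the parts disjoint by shrinking them does not increase their diameters. -/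
def Divisible {E : Type*} [PseudoMetricSpace E] (X : Set E) (m : ℕ) : Prop :=
  ∃ P : Fin m → Set E, X = ⋃ i, P i ∧ ∀ i, Metric.diam (P i) < Metric.diam X

/-- Borsuk's conjecture in dimension `n`: every bounded set of at least two points of the
`n`-dimensional Euclidean space can be divided into `n + 1` parts of smaller diameter. -/
def BorsukConjecture (n : ℕ) : Prop :=
  ∀ X : Set (EuclideanSpace ℝ (Fin n)),
    Bornology.IsBounded X → X.Nontrivial → Divisible X (n + 1)

/-- `X` is a counterexample to Borsuk's conjecture in dimension `n`. -/
def IsBorsukCounterexample (n : ℕ) (X : Set (EuclideanSpace ℝ (Fin n))) : Prop :=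
  Bornology.IsBounded X ∧ X.Nontrivial ∧ ¬ Divisible X (n + 1)

/-- The point set `K` of some Euclidean space is, up to congruence, a counterexample to Borsuk's
conjecture in dimension `n`: an isometric copy of `K` in the `n`-dimensional Euclidean space
exists and is such a counterexample. -/
def GivesCounterexample {ι : Type*} [Fintype ι] (K : Set (EuclideanSpace ℝ ι)) (n : ℕ) : Prop :=
  ∃ X : Set (EuclideanSpace ℝ (Fin n)), Nonempty (K ≃ᵢ X) ∧ IsBorsukCounterexample n X

/-- The set `W` of all two-element subsets of a set of `m` elements. -/
abbrev Pairs (m : ℕ) : Type := {e : Finset (Fin m) // e.card = 2}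

/-- `S(A)`, the set of all pairs `{a, b}` with `a ∈ A` and `b ∉ A`. -/
def splitPairs {m : ℕ} (A : Finset (Fin m)) : Finset (Finset (Fin m)) :=
  Finset.image₂ (fun a b => {a, b}) A Aᶜ

/-- `S(A)` as a `{0,1}`-vector with index set `W`. -/
noncomputable def splitVector {m : ℕ} (A : Finset (Fin m)) : EuclideanSpace ℝ (Pairs m) :=
  WithLp.toLp 2 fun e => if e.1 ∈ splitPairs A then 1 else 0

/-- The Kahn-Kalai point set of parameter `k`: all `S(A)`, where `A` runs through the
`2k`-element subsets of a set of `4k` elements. -/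
def kahnKalaiSet (k : ℕ) : Set (EuclideanSpace ℝ (Pairs (4 * k))) :=
  {x | ∃ A : Finset (Fin (4 * k)), A.card = 2 * k ∧ x = splitVector A}

/-- `q(k) = (1/2) C(4k, 2k) / C(4k - 1, k - 1)` -/
noncomputable def q (k : ℕ) : ℝ :=
  (1 / 2 : ℝ) * ((4 * k).choose (2 * k) : ℝ) / ((4 * k - 1).choose (k - 1) : ℝ)

/-- The range of dimensions belonging to `k`: from `C(4k, 2) - 1` on, below `q(k) - 1`. -/
def dimRange (k : ℕ) : Set ℕ :=
  {d | (4 * k).choose 2 - 1 ≤ d ∧ (d : ℝ) < q k - 1}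

/-- The values of `k` used: the powers of two from 16 on, and `p`. -/
def params (p : ℕ) : Set ℕ :=
  {k | (∃ j : ℕ, 4 ≤ j ∧ k = 2 ^ j) ∨ k = p}

end BorsukKK

/-!
Two splittings `A`, `B` of a `4k`-set into halves have sign vectors `x`, `y ∈ {1, -1}^V`, and
`{a, b} ∈ S(A)` exactly when `x a * x b = -1`. Summing over pairs, the squared distance of `S(A)`
and `S(B)` is `4k² - ((∑ x a * y a) / 2)²`, so the diameter `2k` of the Kahn-Kalai set is attained
precisely when `#(A ∩ B) = k` (`dist_splitVector_sq_of_card`). A part of smaller diameter is thus a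
family of half-size sets, which may be assumed to contain a fixed element `v` because
`S(A) = S(Aᶜ)`, without two members meeting in `k` elements.

For a prime power `k = p ^ m` such a family has at most `C(4k - 1, k - 1)` members
(`card_le_of_card_inter_ne`, a theorem of Frankl and Wilson): let `N` be the incidence matrix over
`ZMod p` between the members and the `(k - 1)`-subsets of `V \ {v}`. The entry of `N * Nᵀ` at
`(A, B)` is `C(#(A ∩ B) - 1, k - 1)`, which modulo `p` vanishes off the diagonal and is `1` on it.
So `N * Nᵀ = 1`, and `N` has at least as many columns as rows. As there are `C(4k, 2k) / 2` sets `A`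
containing `v`, at least `q k` parts are needed.

All vectors `S(A)` have coordinate sum `4k²`, so they lie in a hyperplane of `ℝ^W`, which embeds
isometrically in `ℝ^d` as soon as `C(4k, 2) - 1 ≤ d`.

The ranges of dimensions chain together since each parameter `k` is followed by a parameter `l` with
`C(4l, 2) ≤ q k` (`exists_next_param`). For `k = 16` and `l = p ≤ 29` this is a numerical check; for
`k ≥ 17` it follows from `l ≤ 2k` and `32k² ≤ q k`, where the latter is an induction on `k` using
the quotient `q (k + 1) / q k ≥ 3 / 2`.
-/


namespace BorsukKK

open Finset

/-! ### Families of sets without a forbidden intersection size -/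

/-- A case of Lucas's theorem for prime powers, read off from
`(1 + X) ^ (p ^ m + r) = (1 + X ^ p ^ m) * (1 + X) ^ r` in characteristic `p`. -/
theorem choose_prime_pow_add {p : ℕ} [Fact p.Prime] (m r j : ℕ) (hj : j < p ^ m) :
    ((p ^ m + r).choose j : ZMod p) = (r.choose j : ZMod p) := by
  have h : ((1 + Polynomial.X : Polynomial (ZMod p)) ^ (p ^ m + r)).coeff j =
      ((1 + Polynomial.X : Polynomial (ZMod p)) ^ r).coeff j := by
    rw [pow_add, add_pow_char_pow, one_pow, add_mul, one_mul, Polynomial.coeff_add,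
      mul_comm, Polynomial.coeff_mul_X_pow', if_neg (by omega), add_zero]
  simpa [Polynomial.coeff_one_add_X_pow] using h

/-- The Frankl-Wilson bound for families of `2k`-sets through a fixed point `v`, no two of which meet
in exactly `k` points. The case `A = B` of the hypothesis `hF` is harmless, as `2 * k ≠ k`. -/
theorem card_le_of_card_inter_ne {V : Type*} [Fintype V] [DecidableEq V] {k : ℕ}
    (hk : IsPrimePow k) (v : V) (F : Finset (Finset V)) (hcard : ∀ A ∈ F, #A = 2 * k)
    (hv : ∀ A ∈ F, v ∈ A) (hF : ∀ A ∈ F, ∀ B ∈ F, #(A ∩ B) ≠ k) :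
    #F ≤ (Fintype.card V - 1).choose (k - 1) := by
  obtain ⟨p, m, hp, hm, rfl⟩ := (isPrimePow_nat_iff k).1 hk
  have : Fact p.Prime := ⟨hp⟩
  set k := p ^ m with hkdef
  have hk0 : 0 < k := hk.pos
  let N : Matrix F (powersetCard (k - 1) (univ.erase v)) (ZMod p) :=
    Matrix.of fun A J => if J.1 ⊆ A.1 then 1 else 0
  have hN (A B : F) : (N * N.transpose) A B = ((#(A.1 ∩ B.1) - 1).choose (k - 1) : ℕ) := by
    have hvAB : v ∈ A.1 ∩ B.1 := mem_inter.2 ⟨hv _ A.2, hv _ B.2⟩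
    have h1 : (powersetCard (k - 1) (univ.erase v)).filter (fun J => J ⊆ A.1 ∧ J ⊆ B.1) =
        powersetCard (k - 1) ((A.1 ∩ B.1).erase v) := by
      ext J
      simp only [mem_filter, mem_powersetCard, subset_erase, subset_univ, true_and, subset_inter_iff]
      tauto
    rw [← card_erase_of_mem hvAB, ← card_powersetCard, ← h1, card_filter, Nat.cast_sum,
      ← sum_coe_sort]
    simp only [Matrix.mul_apply, Matrix.transpose_apply, Matrix.of_apply, N]
    refine sum_congr rfl fun J _ => ?_
    by_cases hA : J.1 ⊆ A.1 <;> by_cases hB : J.1 ⊆ B.1 <;> simp [hA, hB]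
  have hone : N * N.transpose = 1 := by
    ext A B
    rw [hN, Matrix.one_apply]
    split_ifs with hAB
    · subst hAB
      rw [inter_self, hcard _ A.2, show 2 * k - 1 = p ^ m + (k - 1) by omega,
        choose_prime_pow_add _ _ _ (Nat.sub_one_lt hk0.ne'), Nat.choose_self, Nat.cast_one]
    · have hlt : #(A.1 ∩ B.1) < 2 * k := by
        rw [← hcard _ A.2]
        refine card_lt_card (inter_subset_left.ssubset_of_ne fun h => hAB (Subtype.ext ?_))
        exact eq_of_subset_of_card_le (inter_eq_left.1 h) (by rw [hcard _ A.2, hcard _ B.2])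
      have hne := hF _ A.2 _ B.2
      have hpos : 0 < #(A.1 ∩ B.1) := card_pos.2 ⟨v, mem_inter.2 ⟨hv _ A.2, hv _ B.2⟩⟩
      rcases lt_or_gt_of_ne hne with h | h
      -- With `s = #(A ∩ B) - 1`, either `s < k - 1`, or `s = k + r` with `r < k - 1`.
      · rw [Nat.choose_eq_zero_of_lt (by omega), Nat.cast_zero]
      · rw [show #(A.1 ∩ B.1) - 1 = p ^ m + (#(A.1 ∩ B.1) - 1 - k) by omega,
          choose_prime_pow_add _ _ _ (Nat.sub_one_lt hk0.ne'), Nat.choose_eq_zero_of_lt (by omega),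
          Nat.cast_zero]
  have h2 := (Matrix.rank_mul_le_left N N.transpose).trans (Matrix.rank_le_card_width N)
  rw [hone, Matrix.rank_one] at h2
  rwa [Fintype.card_coe, Fintype.card_coe, card_powersetCard, card_erase_of_mem (mem_univ v),
    card_univ] at h2

/-- Complementation exchanges the half-size sets containing `v` with those that do not. -/
theorem card_filter_mem_mul_two {V : Type*} [Fintype V] [DecidableEq V] {n : ℕ}
    (hV : Fintype.card V = 2 * n) (v : V) :
    2 * #{A ∈ powersetCard n (univ : Finset V) | v ∈ A} = (2 * n).choose n := by
  have h := card_filter_add_card_filter_not (s := powersetCard n (univ : Finset V)) (fun A => v ∈ A)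
  rw [card_powersetCard, card_univ, hV] at h
  rw [← h, two_mul, Nat.add_left_cancel_iff]
  refine card_bij' (fun A _ => Aᶜ) (fun A _ => Aᶜ) ?_ ?_ ?_ ?_ <;>
    simp +contextual [mem_powersetCard, card_compl, hV] <;> omega

/-! ### Point sets in a hyperplane -/

theorem exists_linearIsometry_euclideanSpace {U : Type*} [NormedAddCommGroup U]
    [InnerProductSpace ℝ U] [FiniteDimensional ℝ U] {d : ℕ} (h : Module.finrank ℝ U ≤ d) :
    Nonempty (U →ₗᵢ[ℝ] EuclideanSpace ℝ (Fin d)) := by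
  let b := stdOrthonormalBasis ℝ U
  let c := EuclideanSpace.basisFun (Fin d) ℝ
  refine ⟨(b.toBasis.constr ℝ (c ∘ Fin.castLE h)).isometryOfOrthonormal (v := b.toBasis)
    (by simp) ?_⟩
  have : (b.toBasis.constr ℝ (c ∘ Fin.castLE h)) ∘ b.toBasis = c ∘ Fin.castLE h := by
    ext1 i; simp
  rw [this]
  exact c.orthonormal.comp _ (Fin.castLE_injective h)

/-- Points of a hyperplane `⟪w, x⟫ = c` differ by vectors orthogonal to `w`, so projecting them to
`(ℝ ∙ w)ᗮ` preserves distances. -/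
theorem exists_isometry_of_subset_hyperplane {E : Type*} [NormedAddCommGroup E]
    [InnerProductSpace ℝ E] [FiniteDimensional ℝ E] {d : ℕ} (hd : Module.finrank ℝ E ≤ d + 1)
    {w : E} (hw : w ≠ 0) {c : ℝ} {s : Set E} (hs : ∀ x ∈ s, inner ℝ w x = c) :
    ∃ f : s → EuclideanSpace ℝ (Fin d), Isometry f := by
  have hU : Module.finrank ℝ (ℝ ∙ w)ᗮ ≤ d := by
    have h1 := (ℝ ∙ w).finrank_add_finrank_orthogonal
    rw [finrank_span_singleton hw] at h1
    omega
  obtain ⟨L⟩ := exists_linearIsometry_euclideanSpace hU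
  refine ⟨fun x => L ((ℝ ∙ w)ᗮ.orthogonalProjectionOnto x.1), Isometry.of_dist_eq fun x y => ?_⟩
  have hxy : x.1 - y.1 ∈ (ℝ ∙ w)ᗮ := by
    rw [Submodule.mem_orthogonal_singleton_iff_inner_right, inner_sub_right, hs _ x.2, hs _ y.2,
      sub_self]
  rw [L.dist_map, dist_eq_norm, ← map_sub, Subtype.dist_eq, dist_eq_norm]
  change ‖(((ℝ ∙ w)ᗮ.orthogonalProjectionOnto (x.1 - y.1) : (ℝ ∙ w)ᗮ) : E)‖ = _
  rw [Submodule.coe_orthogonalProjectionOnto_apply, Submodule.starProjection_eq_self_iff.2 hxy]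

/-! ### Distances between the vectors of splittings -/

/-- A sum over unordered pairs is half the sum over ordered pairs of distinct elements. -/
theorem two_mul_sum_pairs {m : ℕ} (F : Finset (Fin m) → ℝ) :
    2 * ∑ e : Pairs m, F e.1 = ∑ a, ∑ b, if a = b then 0 else F {a, b} := by
  have h1 : ∑ e : Pairs m, F e.1 = ∑ e ∈ powersetCard 2 (univ : Finset (Fin m)), F e :=
    (sum_subtype _ (by simp [mem_powersetCard]) F).symm
  have h2 : ∑ a, ∑ b, (if a = b then 0 else F {a, b}) =
      ∑ x ∈ (univ : Finset (Fin m)).offDiag, F {x.1, x.2} := by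
    have h : (univ : Finset (Fin m)).offDiag =
        {x ∈ (univ : Finset (Fin m × Fin m)) | ¬ x.1 = x.2} := by
      ext x; simp
    rw [h, sum_filter, Fintype.sum_prod_type]
    simp only [ite_not]
  have h3 : ∀ x ∈ (univ : Finset (Fin m)).offDiag,
      ({x.1, x.2} : Finset (Fin m)) ∈ powersetCard 2 univ := fun x hx => by
    simpa [mem_powersetCard] using card_pair (mem_offDiag.1 hx).2.2
  rw [h1, h2, ← sum_fiberwise_of_maps_to h3, mul_sum]
  refine sum_congr rfl fun e he => ?_
  obtain ⟨a, b, hab, rfl⟩ := card_eq_two.1 (mem_powersetCard.1 he).2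
  have h4 : {x ∈ (univ : Finset (Fin m)).offDiag | ({x.1, x.2} : Finset (Fin m)) = {a, b}} =
      {(a, b), (b, a)} := by
    ext ⟨x, y⟩
    simp only [mem_filter, mem_offDiag, mem_univ, true_and, mem_insert, mem_singleton,
      Prod.mk.injEq]
    constructor
    · rintro ⟨hxy, h⟩
      have hx : x ∈ ({a, b} : Finset (Fin m)) := h ▸ mem_insert_self _ _
      have hy : y ∈ ({a, b} : Finset (Fin m)) := h ▸ (by simp)
      simp only [mem_insert, mem_singleton] at hx hy
      grind
    · rintro (⟨rfl, rfl⟩ | ⟨rfl, rfl⟩)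
      · exact ⟨hab, rfl⟩
      · exact ⟨hab.symm, pair_comm _ _⟩
  rw [sum_congr rfl fun x hx => by rw [(mem_filter.1 hx).2], h4, sum_const,
    card_pair (by simp [hab]), nsmul_eq_mul]
  norm_num

/-- The sign vector of `A`: `1` on `A` and `-1` off `A`. -/
def signVec {V : Type*} [DecidableEq V] (A : Finset V) (a : V) : ℝ := if a ∈ A then 1 else -1

theorem signVec_mul_self {V : Type*} [DecidableEq V] (A : Finset V) (a : V) :
    signVec A a * signVec A a = 1 := by
  unfold signVec; split_ifs <;> norm_num

theorem sum_signVec {V : Type*} [Fintype V] [DecidableEq V] (A : Finset V) :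
    ∑ a, signVec A a = 2 * (#A : ℝ) - Fintype.card V := by
  have h (a : V) : signVec A a = 2 * (if a ∈ A then 1 else 0) - 1 := by
    unfold signVec; split_ifs <;> norm_num
  simp [h, sum_sub_distrib, mul_comm]

/-- The singleton case `a = b` is included: both sides are then `0`. -/
theorem indicator_splitPairs {m : ℕ} (A : Finset (Fin m)) (a b : Fin m) :
    (if ({a, b} : Finset (Fin m)) ∈ splitPairs A then 1 else 0 : ℝ) =
      (1 - signVec A a * signVec A b) / 2 := by
  have h : ({a, b} : Finset (Fin m)) ∈ splitPairs A ↔ ¬ (a ∈ A ↔ b ∈ A) := by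
    simp only [splitPairs, mem_image₂, mem_compl]
    constructor
    · rintro ⟨x, hx, y, hy, h⟩
      have hx' : x ∈ ({a, b} : Finset (Fin m)) := h ▸ mem_insert_self _ _
      have hy' : y ∈ ({a, b} : Finset (Fin m)) := h ▸ (by simp)
      simp only [mem_insert, mem_singleton] at hx' hy'
      grind
    · intro h
      by_cases ha : a ∈ A
      · exact ⟨a, ha, b, by tauto, rfl⟩
      · exact ⟨b, by tauto, a, ha, pair_comm _ _⟩
  simp only [h, signVec]
  by_cases ha : a ∈ A <;> by_cases hb : b ∈ A <;> norm_num [ha, hb]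

theorem sum_sum_one_sub_mul {V : Type*} [Fintype V] (z : V → ℝ) :
    ∑ a, ∑ b, (1 - z a * z b) = (Fintype.card V : ℝ) ^ 2 - (∑ a, z a) ^ 2 := by
  simp only [sum_sub_distrib, sq, sum_mul_sum]
  simp

theorem sum_splitVector {m : ℕ} (A : Finset (Fin m)) :
    ∑ e, splitVector A e = ((m : ℝ) ^ 2 - (2 * (#A : ℝ) - m) ^ 2) / 4 := by
  have h := two_mul_sum_pairs (m := m) fun e => if e ∈ splitPairs A then 1 else 0
  have h1 (a b : Fin m) : (if a = b then 0 else
      if ({a, b} : Finset (Fin m)) ∈ splitPairs A then 1 else 0 : ℝ) =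
      (1 - signVec A a * signVec A b) / 2 := by
    split_ifs with hab
    · rw [hab, signVec_mul_self]; norm_num
    all_goals simp_all [← indicator_splitPairs]
  simp only [h1, ← sum_div, sum_sum_one_sub_mul, sum_signVec, Fintype.card_fin] at h
  change ∑ e : Pairs m, (if e.1 ∈ splitPairs A then 1 else 0 : ℝ) = _
  linarith

theorem dist_splitVector_sq {m : ℕ} (A B : Finset (Fin m)) :
    dist (splitVector A) (splitVector B) ^ 2 =
      ((m : ℝ) ^ 2 - (∑ a, signVec A a * signVec B a) ^ 2) / 4 := by
  have h := two_mul_sum_pairs (m := m) fun e =>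
    ((if e ∈ splitPairs A then 1 else 0) - (if e ∈ splitPairs B then 1 else 0)) ^ 2
  have h1 (a b : Fin m) : (if a = b then 0 else
      ((if ({a, b} : Finset (Fin m)) ∈ splitPairs A then 1 else 0) -
        (if ({a, b} : Finset (Fin m)) ∈ splitPairs B then 1 else 0)) ^ 2 : ℝ) =
      (1 - (signVec A a * signVec B a) * (signVec A b * signVec B b)) / 2 := by
    rw [indicator_splitPairs, indicator_splitPairs]
    have hA := signVec_mul_self A a
    have hB := signVec_mul_self B a
    have hA' := signVec_mul_self A b
    have hB' := signVec_mul_self B b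
    split_ifs with hab
    · subst hab; linear_combination (signVec B a * signVec B a) / 2 * hA + hB / 2
    · linear_combination (signVec A b * signVec A b) / 4 * hA + hA' / 4 +
        (signVec B b * signVec B b) / 4 * hB + hB' / 4
  simp only [h1, ← sum_div, sum_sum_one_sub_mul, Fintype.card_fin] at h
  rw [EuclideanSpace.dist_eq, Real.sq_sqrt (sum_nonneg fun _ _ => sq_nonneg _)]
  simp only [Real.dist_eq, sq_abs]
  change ∑ e : Pairs m, ((if e.1 ∈ splitPairs A then 1 else 0) -
    (if e.1 ∈ splitPairs B then 1 else 0) : ℝ) ^ 2 = _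
  linarith

theorem sum_signVec_mul_signVec {V : Type*} [Fintype V] [DecidableEq V] (A B : Finset V) :
    ∑ a, signVec A a * signVec B a = 4 * (#(A ∩ B) : ℝ) - 2 * #A - 2 * #B + Fintype.card V := by
  have h (a : V) : signVec A a * signVec B a = 4 * (if a ∈ A ∩ B then 1 else 0) -
      2 * (if a ∈ A then 1 else 0) - 2 * (if a ∈ B then 1 else 0) + 1 := by
    unfold signVec
    by_cases ha : a ∈ A <;> by_cases hb : a ∈ B <;> norm_num [ha, hb]
  simp only [h, sum_add_distrib, sum_sub_distrib, ← mul_sum, sum_boole, filter_mem_eq_inter]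
  simp

/-! ### Growth of `q` -/

theorem q_eq_factorial {k : ℕ} (hk : 0 < k) :
    q k = 2 * (k.factorial * (3 * k).factorial) / ((2 * k).factorial : ℝ) ^ 2 := by
  obtain ⟨n, rfl⟩ := Nat.exists_eq_succ_of_ne_zero hk.ne'
  simp only [Nat.succ_eq_add_one]
  have h1 : ((4 * (n + 1)).choose (2 * (n + 1)) : ℝ) =
      (4 * (n + 1)).factorial / ((2 * (n + 1)).factorial * (2 * (n + 1)).factorial) := by
    rw [Nat.cast_choose ℝ (by omega), show 4 * (n + 1) - 2 * (n + 1) = 2 * (n + 1) by omega]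
  have h2 : ((4 * (n + 1) - 1).choose (n + 1 - 1) : ℝ) =
      (4 * n + 3).factorial / (n.factorial * (3 * (n + 1)).factorial) := by
    rw [Nat.cast_choose ℝ (by omega), show 4 * (n + 1) - 1 - (n + 1 - 1) = 3 * (n + 1) by omega]
    rfl
  have h3 : ((4 * (n + 1)).factorial : ℝ) = 4 * (n + 1) * (4 * n + 3).factorial := by
    rw [show 4 * (n + 1) = (4 * n + 3) + 1 by ring, Nat.factorial_succ]; push_cast; ring
  have h4 : ((n + 1).factorial : ℝ) = (n + 1) * n.factorial := by
    rw [Nat.factorial_succ]; push_cast; ring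
  have := Nat.cast_ne_zero (R := ℝ).2 (4 * n + 3).factorial_ne_zero
  have := Nat.cast_ne_zero (R := ℝ).2 n.factorial_ne_zero
  have := Nat.cast_ne_zero (R := ℝ).2 (3 * (n + 1)).factorial_ne_zero
  have := Nat.cast_ne_zero (R := ℝ).2 (2 * (n + 1)).factorial_ne_zero
  rw [q, h1, h2, h3, h4]
  field_simp
  ring

theorem q_succ {k : ℕ} (hk : 0 < k) :
    q (k + 1) = q k * (3 * (3 * k + 1) * (3 * k + 2) / (4 * (2 * k + 1) ^ 2)) := by
  rw [q_eq_factorial hk, q_eq_factorial k.succ_pos]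
  rw [show 3 * (k + 1) = 3 * k + 1 + 1 + 1 by ring, show 2 * (k + 1) = 2 * k + 1 + 1 by ring]
  simp only [Nat.factorial_succ]
  have := Nat.cast_ne_zero (R := ℝ).2 (2 * k).factorial_ne_zero
  push_cast
  field_simp
  ring

/-- The value of `q 16` is about `7500`, whereas `C(116, 2) = 6670`. -/
theorem choose_two_le_q_sixteen : ((4 * 29).choose 2 : ℝ) ≤ q 16 := by
  rw [q, le_div_iff₀ (by exact_mod_cast Nat.choose_pos (by norm_num))]
  norm_num [Nat.choose]

theorem sq_le_q {k : ℕ} (hk : 17 ≤ k) : 32 * (k : ℝ) ^ 2 ≤ q k := by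
  induction k, hk using Nat.le_induction with
  | base =>
    have := q_succ (k := 16) (by norm_num)
    have := choose_two_le_q_sixteen
    norm_num [Nat.choose] at *
    linarith
  | succ k hk ih =>
    have hk' : (17 : ℝ) ≤ k := by exact_mod_cast hk
    rw [q_succ (by omega)]
    have h1 : (3 / 2 : ℝ) ≤ 3 * (3 * k + 1) * (3 * k + 2) / (4 * (2 * k + 1) ^ 2) := by
      rw [le_div_iff₀ (by positivity)]; nlinarith
    have h2 := mul_le_mul ih h1 (by norm_num) ((by positivity : (0:ℝ) ≤ _).trans ih)
    push_cast
    nlinarith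

/-! ### The Kahn-Kalai sets as counterexamples -/

theorem dist_splitVector_sq_of_card {k : ℕ} {A B : Finset (Fin (4 * k))} (hA : #A = 2 * k)
    (hB : #B = 2 * k) :
    dist (splitVector A) (splitVector B) ^ 2 =
      (2 * k : ℝ) ^ 2 - (2 * ((#(A ∩ B) : ℝ) - k)) ^ 2 := by
  rw [dist_splitVector_sq, sum_signVec_mul_signVec, hA, hB, Fintype.card_fin]
  push_cast
  ring

theorem diam_kahnKalaiSet_le (k : ℕ) : Metric.diam (kahnKalaiSet k) ≤ 2 * k := by
  refine Metric.diam_le_of_forall_dist_le (by positivity) ?_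
  rintro _ ⟨A, hA, rfl⟩ _ ⟨B, hB, rfl⟩
  refine le_of_sq_le_sq ?_ (by positivity)
  rw [dist_splitVector_sq_of_card hA hB]
  exact sub_le_self _ (sq_nonneg _)

theorem dist_splitVector_of_card_inter {k : ℕ} {A B : Finset (Fin (4 * k))} (hA : #A = 2 * k)
    (hB : #B = 2 * k) (hAB : #(A ∩ B) = k) : dist (splitVector A) (splitVector B) = 2 * k := by
  rw [← sq_eq_sq₀ dist_nonneg (by positivity), dist_splitVector_sq_of_card hA hB, hAB]
  ring

theorem finite_kahnKalaiSet (k : ℕ) : (kahnKalaiSet k).Finite := by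
  refine (Set.finite_range (splitVector (m := 4 * k))).subset ?_
  rintro _ ⟨A, -, rfl⟩
  exact ⟨A, rfl⟩

/-- The family of half-size sets through `v` is `q k` times as large as the Frankl-Wilson bound. -/
theorem q_mul_choose {k : ℕ} (v : Fin (4 * k)) :
    q k * (4 * k - 1).choose (k - 1) =
      #{A ∈ powersetCard (2 * k) (univ : Finset (Fin (4 * k))) | v ∈ A} := by
  have hv := v.pos
  have h := card_filter_mem_mul_two (n := 2 * k) (by rw [Fintype.card_fin]; ring) v
  rw [show 2 * (2 * k) = 4 * k by ring] at h
  have h' : ((4 * k - 1).choose (k - 1) : ℝ) ≠ 0 :=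
    Nat.cast_ne_zero.2 (Nat.choose_pos (by omega)).ne'
  rw [q, div_mul_cancel₀ _ h', ← h]
  push_cast
  ring

/-- Fewer than `q k` parts do not separate the Kahn-Kalai set: by the pigeonhole principle one of them
contains more than `C(4k - 1, k - 1)` of the `q k * C(4k - 1, k - 1)` sets through a fixed point. -/
theorem exists_mem_part_card_inter_eq {k d : ℕ} (hk : IsPrimePow k) (hd : (d : ℝ) + 1 < q k)
    {P : Fin (d + 1) → Set (EuclideanSpace ℝ (Pairs (4 * k)))} (hP : kahnKalaiSet k ⊆ ⋃ i, P i) :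
    ∃ i, ∃ A B : Finset (Fin (4 * k)), splitVector A ∈ P i ∧ splitVector B ∈ P i ∧
      #A = 2 * k ∧ #B = 2 * k ∧ #(A ∩ B) = k := by
  classical
  have hk0 := hk.pos
  let v : Fin (4 * k) := ⟨0, by omega⟩
  set G := {A ∈ powersetCard (2 * k) (univ : Finset (Fin (4 * k))) | v ∈ A} with hG
  have hcard (A : Finset (Fin (4 * k))) (hA : A ∈ G) : #A = 2 * k := by
    simp only [hG, mem_filter, mem_powersetCard] at hA
    exact hA.1.2
  have hcol (A : Finset (Fin (4 * k))) : ∃ i, A ∈ G → splitVector A ∈ P i := by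
    by_cases hA : A ∈ G
    · obtain ⟨i, hi⟩ := Set.mem_iUnion.1 (hP ⟨A, hcard A hA, rfl⟩)
      exact ⟨i, fun _ => hi⟩
    · exact ⟨0, fun h => absurd h hA⟩
  choose col hcol using hcol
  have hlt : #(univ : Finset (Fin (d + 1))) * (4 * k - 1).choose (k - 1) < #G := by
    rw [card_univ, Fintype.card_fin, ← Nat.cast_lt (α := ℝ), ← q_mul_choose]
    push_cast
    exact mul_lt_mul_of_pos_right hd (Nat.cast_pos.2 (Nat.choose_pos (by omega)))
  obtain ⟨i, -, hi⟩ := exists_lt_card_fiber_of_mul_lt_card_of_maps_to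
    (fun A _ => mem_univ (col A)) hlt
  by_contra! hcon
  refine hi.not_ge ?_
  have h := card_le_of_card_inter_ne hk v {A ∈ G | col A = i}
    (fun A hA => hcard A (mem_filter.1 hA).1)
    (fun A hA => (mem_filter.1 (mem_filter.1 hA).1).2) fun A hA B hB => ?_
  · rwa [Fintype.card_fin] at h
  · obtain ⟨hAG, hAi⟩ := mem_filter.1 hA
    obtain ⟨hBG, hBi⟩ := mem_filter.1 hB
    exact hcon i A B (hAi ▸ hcol A hAG) (hBi ▸ hcol B hBG) (hcard A hAG) (hcard B hBG)

/-- With a single part, `exists_mem_part_card_inter_eq` produces two points at distance `2k`. -/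
theorem kahnKalaiSet_nontrivial {k : ℕ} (hk : IsPrimePow k) (hq : 1 < q k) :
    (kahnKalaiSet k).Nontrivial := by
  obtain ⟨-, A, B, -, -, hA, hB, hAB⟩ := exists_mem_part_card_inter_eq (d := 0) hk (by simpa)
    (P := fun _ => Set.univ) (fun _ _ => by simp)
  refine ⟨_, ⟨A, hA, rfl⟩, _, ⟨B, hB, rfl⟩, dist_pos.1 ?_⟩
  rw [dist_splitVector_of_card_inter hA hB hAB]
  have := hk.pos
  positivity

theorem not_divisible_kahnKalaiSet {k d : ℕ} (hk : IsPrimePow k) (hd : (d : ℝ) + 1 < q k) :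
    ¬ Divisible (kahnKalaiSet k) (d + 1) := by
  rintro ⟨P, hP, hdiam⟩
  obtain ⟨i, A, B, hAi, hBi, hA, hB, hAB⟩ := exists_mem_part_card_inter_eq hk hd hP.subset
  have hbdd : Bornology.IsBounded (P i) :=
    (finite_kahnKalaiSet k).isBounded.subset (hP ▸ Set.subset_iUnion P i)
  have h1 := Metric.dist_le_diam_of_mem hbdd hAi hBi
  rw [dist_splitVector_of_card_inter hA hB hAB] at h1
  exact ((hdiam i).trans_le (diam_kahnKalaiSet_le k)).not_ge h1

theorem Divisible.of_isometry {E F : Type*} [PseudoMetricSpace E] [PseudoMetricSpace F]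
    {s : Set E} {f : s → F} (hf : Isometry f) {m : ℕ} (h : Divisible (Set.range f) m) :
    Divisible s m := by
  obtain ⟨P, hP, hdiam⟩ := h
  refine ⟨fun i => Subtype.val '' (f ⁻¹' P i), ?_, fun i => ?_⟩
  · rw [← Set.image_iUnion, ← Set.preimage_iUnion, ← hP, Set.preimage_range, Set.image_univ,
      Subtype.range_coe]
  · have h1 : f '' (f ⁻¹' P i) = P i :=
      Set.image_preimage_eq_of_subset (hP ▸ Set.subset_iUnion P i)
    have h2 : Metric.diam s = Metric.diam (Set.range f) := by
      rw [hf.diam_range, ← isometry_subtype_coe.diam_range, Subtype.range_coe]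
    rw [isometry_subtype_coe.diam_image, ← hf.diam_image, h1, h2]
    exact hdiam i

theorem exists_isometry_kahnKalaiSet {k d : ℕ} (hk : 0 < k) (hd : (4 * k).choose 2 - 1 ≤ d) :
    ∃ f : kahnKalaiSet k → EuclideanSpace ℝ (Fin d), Isometry f := by
  have hrank : Module.finrank ℝ (EuclideanSpace ℝ (Pairs (4 * k))) = (4 * k).choose 2 := by
    rw [finrank_euclideanSpace, Fintype.card_finset_len, Fintype.card_fin]
  let e : Pairs (4 * k) :=
    ⟨{(⟨0, by omega⟩ : Fin (4 * k)), ⟨1, by omega⟩}, card_pair (by simp [Fin.ext_iff])⟩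
  refine exists_isometry_of_subset_hyperplane (w := WithLp.toLp 2 fun _ => 1)
    (c := 4 * (k : ℝ) ^ 2) (by rw [hrank]; omega) (fun h => ?_) ?_
  · simpa using congrArg (fun x : EuclideanSpace ℝ (Pairs (4 * k)) => x e) h
  · rintro _ ⟨A, hA, rfl⟩
    have h := sum_splitVector A
    rw [hA] at h
    simp only [PiLp.inner_apply, RCLike.inner_apply, conj_trivial, mul_one, h]
    push_cast
    ring

theorem givesCounterexample_kahnKalaiSet {k d : ℕ} (hk : IsPrimePow k) (hd : d ∈ dimRange k) :
    GivesCounterexample (kahnKalaiSet k) d := by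
  obtain ⟨hd1, hd2⟩ := hd
  obtain ⟨f, hf⟩ := exists_isometry_kahnKalaiSet hk.pos hd1
  have hd0 : (0 : ℝ) ≤ d := d.cast_nonneg
  have : Finite (kahnKalaiSet k) := (finite_kahnKalaiSet k).to_subtype
  have : Nontrivial (kahnKalaiSet k) :=
    (kahnKalaiSet_nontrivial hk (by linarith)).coe_sort
  refine ⟨Set.range f, ⟨hf.isometryEquivOnRange⟩, (Set.finite_range f).isBounded, ?_, fun h => ?_⟩
  · rw [← Set.image_univ]
    exact Set.nontrivial_univ.image hf.injective
  · exact not_divisible_kahnKalaiSet hk (by linarith) (h.of_isometry hf)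

/-! ### The ranges of dimensions -/

theorem choose_two_mono {k l : ℕ} (h : k ≤ l) : (4 * k).choose 2 ≤ (4 * l).choose 2 :=
  Nat.choose_le_choose 2 (by omega)

theorem choose_two_strictMono {k l : ℕ} (hk : 0 < k) (h : k < l) :
    (4 * k).choose 2 < (4 * l).choose 2 := by
  refine lt_of_lt_of_le ?_ (Nat.choose_le_choose 2 (show 4 * k + 1 ≤ 4 * l by omega))
  have h1 : (4 * k + 1).choose 2 = 4 * k + (4 * k).choose 2 := by
    rw [Nat.choose_succ_succ' (4 * k) 1, Nat.choose_one_right]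
  omega

theorem choose_two_le_q {k l : ℕ} (hk : 17 ≤ k) (hl : l ≤ 2 * k) :
    ((4 * l).choose 2 : ℝ) ≤ q k := by
  refine le_trans ?_ (sq_le_q hk)
  have h : (l : ℝ) ≤ 2 * k := by exact_mod_cast hl
  rw [Nat.cast_choose_two]
  push_cast
  nlinarith [l.cast_nonneg (α := ℝ)]

theorem sixteen_le_of_mem_params {p k : ℕ} (hp : 17 ≤ p) (hk : k ∈ params p) : 16 ≤ k := by
  rcases hk with ⟨j, hj, rfl⟩ | rfl
  · exact Nat.pow_le_pow_right (n := 2) (by norm_num) hj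
  · omega

theorem isPrimePow_of_mem_params {p k : ℕ} (hp : IsPrimePow p) (hk : k ∈ params p) :
    IsPrimePow k := by
  rcases hk with ⟨j, hj, rfl⟩ | rfl
  · exact Nat.prime_two.isPrimePow.pow (by omega)
  · exact hp

/-- The parameter `l` need not be the immediate successor of `k`, but the bound passes on to every
smaller parameter. -/
theorem exists_next_param {p k : ℕ} (hp17 : 17 ≤ p) (hp29 : p ≤ 29) (hk : k ∈ params p) :
    ∃ l ∈ params p, k < l ∧ ((4 * l).choose 2 : ℝ) ≤ q k := by
  have h16 := sixteen_le_of_mem_params hp17 hk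
  rcases h16.eq_or_lt with rfl | h17
  · exact ⟨p, Or.inr rfl, by omega,
      le_trans (Nat.cast_le.2 (choose_two_mono hp29)) choose_two_le_q_sixteen⟩
  rcases hk with ⟨j, hj, rfl⟩ | rfl
  · exact ⟨2 ^ (j + 1), Or.inl ⟨j + 1, by omega, rfl⟩, by omega,
      choose_two_le_q h17 (by omega)⟩
  · exact ⟨2 ^ 5, Or.inl ⟨5, by norm_num, rfl⟩, by omega, choose_two_le_q h17 (by omega)⟩

theorem dimRange_nonempty {k l : ℕ} (hk : 0 < k) (hkl : k < l)
    (hl : ((4 * l).choose 2 : ℝ) ≤ q k) : (dimRange k).Nonempty := by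
  have h := choose_two_strictMono hk hkl
  refine ⟨(4 * k).choose 2 - 1, le_rfl, ?_⟩
  have h1 : 1 ≤ (4 * k).choose 2 := Nat.choose_pos (by omega)
  have h2 : ((4 * k).choose 2 : ℝ) < (4 * l).choose 2 := Nat.cast_lt.2 h
  rw [Nat.cast_sub h1, Nat.cast_one]
  linarith

theorem mem_dimRange_of_lt {k l d : ℕ} (hl : ((4 * l).choose 2 : ℝ) ≤ q k)
    (hkd : (4 * k).choose 2 - 1 ≤ d) (hdl : d < (4 * l).choose 2 - 1) : d ∈ dimRange k := by
  refine ⟨hkd, ?_⟩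
  have h : ((d + 1 + 1 : ℕ) : ℝ) ≤ (4 * l).choose 2 := Nat.cast_le.2 (by omega)
  push_cast at h
  linarith

theorem ordConnected_dimRange_union {k l : ℕ} (hkl : k ≤ l)
    (hl : ((4 * l).choose 2 : ℝ) ≤ q k) : (dimRange k ∪ dimRange l).OrdConnected := by
  have hmono := choose_two_mono hkl
  refine ⟨fun x hx y hy z ⟨hxz, hzy⟩ => ?_⟩
  have hzy' : (z : ℝ) ≤ y := Nat.cast_le.2 hzy
  have hkz : (4 * k).choose 2 - 1 ≤ z := by
    rcases hx with hx | hx <;> have := hx.1 <;> omega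
  rcases lt_or_ge z ((4 * l).choose 2 - 1) with hz | hz
  · exact Or.inl (mem_dimRange_of_lt hl hkz hz)
  · rcases hy with hy | hy
    · exact Or.inl ⟨hkz, hzy'.trans_lt hy.2⟩
    · exact Or.inr ⟨hz, hzy'.trans_lt hy.2⟩

theorem iUnion_dimRange {p : ℕ} (hp17 : 17 ≤ p) (hp29 : p ≤ 29) :
    ⋃ k ∈ params p, dimRange k = Set.Ici 2015 := by
  ext d
  simp only [Set.mem_iUnion, Set.mem_Ici, exists_prop]
  constructor
  · rintro ⟨k, hk, hd, -⟩
    have h := choose_two_mono (sixteen_le_of_mem_params hp17 hk)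
    have h' : (4 * 16).choose 2 = 2016 := rfl
    omega
  · intro hd
    by_contra! hcon
    -- If no range contains `d`, then one parameter with lower end at most `d` leads to a larger one,
    -- so that such parameters are unbounded.
    have hall (n : ℕ) : ∃ k ∈ params p, n ≤ k ∧ (4 * k).choose 2 - 1 ≤ d := by
      induction n with
      | zero => exact ⟨16, Or.inl ⟨4, le_rfl, rfl⟩, Nat.zero_le _, hd⟩
      | succ n ih =>
        obtain ⟨k, hk, hnk, hkd⟩ := ih
        obtain ⟨l, hl, hkl, hlq⟩ := exists_next_param hp17 hp29 hk
        exact ⟨l, hl, by omega, not_lt.1 fun h => hcon k hk (mem_dimRange_of_lt hlq hkd h)⟩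
    obtain ⟨k, -, hdk, hkd⟩ := hall (d + 2)
    have h : 4 * k ≤ (4 * k).choose 2 := by
      obtain ⟨n, hn⟩ := Nat.exists_eq_add_of_le (show 3 ≤ 4 * k by omega)
      rw [hn, Nat.choose_two_right, Nat.le_div_iff_mul_le two_pos]
      exact Nat.mul_le_mul_left _ (by omega)
    omega

end BorsukKK

theorem mainTheorem3 (p : ℕ) (hp : IsPrimePow p) (hp17 : 17 ≤ p) (hp29 : p ≤ 29) :
    (∀ k ∈ BorsukKK.params p, (BorsukKK.dimRange k).Nonempty ∧
      ∀ d ∈ BorsukKK.dimRange k,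
        BorsukKK.GivesCounterexample (BorsukKK.kahnKalaiSet k) d) ∧
    (∀ k ∈ BorsukKK.params p, ∀ k' ∈ BorsukKK.params p, k < k' →
      (∀ l ∈ BorsukKK.params p, ¬ (k < l ∧ l < k')) →
      (BorsukKK.dimRange k ∪ BorsukKK.dimRange k').OrdConnected) ∧
    (⋃ k ∈ BorsukKK.params p, BorsukKK.dimRange k) = Set.Ici 2015 ∧
    (∀ d : ℕ, 2015 ≤ d →
      (∃ k ∈ BorsukKK.params p,
        BorsukKK.GivesCounterexample (BorsukKK.kahnKalaiSet k) d) ∧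
      ¬ BorsukKK.BorsukConjecture d) := by
  have hgives : ∀ k ∈ BorsukKK.params p, ∀ d ∈ BorsukKK.dimRange k,
      BorsukKK.GivesCounterexample (BorsukKK.kahnKalaiSet k) d := fun k hk d hd =>
    BorsukKK.givesCounterexample_kahnKalaiSet (BorsukKK.isPrimePow_of_mem_params hp hk) hd
  have hunion := BorsukKK.iUnion_dimRange hp17 hp29
  refine ⟨fun k hk => ⟨?_, hgives k hk⟩, fun k hk l hl hkl hcons => ?_, hunion, fun d hd => ?_⟩
  · obtain ⟨l, -, hkl, hlq⟩ := BorsukKK.exists_next_param hp17 hp29 hk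
    have := BorsukKK.sixteen_le_of_mem_params hp17 hk
    exact BorsukKK.dimRange_nonempty (by omega) hkl hlq
  · obtain ⟨l', hl', hkl', hlq⟩ := BorsukKK.exists_next_param hp17 hp29 hk
    have hll' : l ≤ l' := not_lt.1 fun h => hcons l' hl' ⟨hkl', h⟩
    exact BorsukKK.ordConnected_dimRange_union hkl.le
      (le_trans (Nat.cast_le.2 (BorsukKK.choose_two_mono hll')) hlq)
  · have hd' : d ∈ ⋃ k ∈ BorsukKK.params p, BorsukKK.dimRange k := hunion ▸ hd
    simp only [Set.mem_iUnion, exists_prop] at hd'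
    obtain ⟨k, hk, hdk⟩ := hd'
    have h := hgives k hk d hdk
    refine ⟨⟨k, hk, h⟩, fun hconj => ?_⟩
    obtain ⟨X, -, hbdd, hnt, hdiv⟩ := h
    exact hdiv (hconj X hbdd hnt)
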